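/- Let $d\ge 3$ and $A\in\mathbb C^{d\times d}$, and let $W(A)=\{\langle Ax,x\rangle : x\in\mathbb C^d,\ \|x\|=1\}$ be the numerical range of $A$. Consider the condition $(C_d)$: there exists a real polynomial $P\in\mathbb R[w]$ (not depending on $\theta$) such that for all $\theta\in\mathbb R$, as an identity in $w$, $$\det\Big(wI-\tfrac12\big(e^{-i\theta}A+e^{i\theta}A^*\big)\Big)=P(w)-\big(-\tfrac12\big)^{d-1}\,\Re\big(e^{-id\theta}\det A\big).$$ (1) If $A$ satisfies $(C_d)$, then $W(A)$ is invariant under the rotation by the angle $2\pi/d$ about $0$. (2) If $\det A\ne0$ and $W(A)$ is invariant under the rotation by the angle $2\pi/d$ about $0$, then $A$ satisfies $(C_d)$; moreover $A^d=(-1)^{d-1}\det(A)\,I$, and $W(A)$ has the same symmetry group as a regular $d$-gon: there is a regular $d$-gon centered at $0$ such that an isometry of the plane maps $W(A)$ onto itself if and only if it maps this $d$-gon onto itself. -/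

import Mathlib

noncomputable section

/-- The numerical range of a complex matrix: all values `⟨A x, x⟩` (the inner product of Mathlib is
conjugate-linear in its first argument) at unit vectors `x` of `ℂ^d`. -/
def numericalRange {d : ℕ} (A : Matrix (Fin d) (Fin d) ℂ) : Set ℂ :=
  {z : ℂ | ∃ x : EuclideanSpace ℂ (Fin d),
    ‖x‖ = 1 ∧ z = inner ℂ x (Matrix.toEuclideanLin A x)}

/-- `S` is invariant under the rotation of angle `α` centered at `0`. -/
def RotationInvariant (S : Set ℂ) (α : ℝ) : Prop :=
  (fun z : ℂ => Complex.exp (α * Complex.I) * z) '' S = S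

/-- Condition `(C_d)`: there is a real polynomial `P`, independent of `θ`, with
`det (w I - (e^{-iθ} A + e^{iθ} A^*)/2) = P(w) - (-1/2)^{d-1} Re (e^{-idθ} det A)`
for all `θ` and `w`. -/
def ConditionC {d : ℕ} (A : Matrix (Fin d) (Fin d) ℂ) : Prop :=
  ∃ P : Polynomial ℝ, ∀ (θ : ℝ) (w : ℂ),
    (w • (1 : Matrix (Fin d) (Fin d) ℂ) - (1 / 2 : ℂ) •
        (Complex.exp (-(θ * Complex.I)) • A
          + Complex.exp (θ * Complex.I) • A.conjTranspose)).det
      = Polynomial.aeval w P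
        - (((-1 / 2 : ℝ) ^ (d - 1)
            * (Complex.exp (-((d : ℂ) * θ * Complex.I)) * A.det).re : ℝ) : ℂ)

/-- The symmetry group of a planar set: the group of all isometries of the plane (rotations,
reflections, translations, glide reflections) that map the set onto itself. -/
def symmetryGroup (S : Set ℂ) : Subgroup (ℂ ≃ᵢ ℂ) where
  carrier := {g | g '' S = S}
  one_mem' := by
    change (fun z : ℂ => z) '' S = S
    exact Set.image_id' S
  mul_mem' := by
    intro a b ha hb
    change (fun z : ℂ => a (b z)) '' S = S
    rw [← Set.image_image, show b '' S = S from hb, show a '' S = S from ha]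
  inv_mem' := by
    intro a ha
    change a.symm '' S = S
    have h : a '' S = S := ha
    conv_lhs => rw [← h]
    rw [Set.image_image]
    simp

/-- The (filled) regular `d`-gon centered at `0` that has `c` as one of its vertices. -/
def regularPolygon (d : ℕ) (c : ℂ) : Set ℂ :=
  convexHull ℝ (Set.range fun k : Fin d =>
    c * Complex.exp (2 * Real.pi * Complex.I * ((k : ℕ) : ℂ) / (d : ℂ)))

end

/-! For `‖z‖ = 1`, the largest eigenvalue of the Hermitian part `hermPart A z` is the support
function of `W(A)` in direction `z`. As `W(A)` is compact and convex, these eigenvalues determine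
it. Under `(C_d)` the characteristic polynomial of `hermPart A z` depends on `z` only through `z ^
d`, which gives (1).

For (2), let `c` be a primitive `d`-th root of unity with `W(cA) = W(A)`. A priori only the largest
eigenvalue `l(z)` is invariant under `z ↦ cz`; `pencilPoly_smul_eq` upgrades this to the whole
pencil `F(X, Y) = det(Y - (A + X Aᴴ)/2)`, where `F(z², wz) = z^d det(w - hermPart A z)`. If the
pencils of `A` and `cA` differ, they have a common monic divisor `G` of degree `m < d` in `Y` and
total degree `m`, with `G(z², l(z)z) = 0` off a finite subset of the circle. Since `l` is constant
on the orbits of `c`, generically `G(x², l(z)x)`, of degree at most `2m < m + d` in `x`, vanishes at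
all `c^k z`, so its coefficient of `x^m` is zero. That coefficient is a nonzero polynomial in
`l(z)`, so `l` takes some value `r` infinitely often. Then `F(x², rx)` is the zero polynomial,
contradicting its value `(-1/2)^d det A` at `0`.

Rotation invariance now leaves only the powers `0`, `d`, `2d` of `z` in `F(z², wz)`; the outer
coefficients produce the real part in `(C_d)`. Setting `X = 0` yields the characteristic polynomial
of `A/2`, and Cayley–Hamilton gives `A^d`. The term `Re(z̄^d det A)` also dictates which rotations
and reflections preserve `W(A)`. -/

noncomputable section

open scoped ComplexConjugate
open Matrix Polynomial

variable {d : ℕ}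

/-! ### Hermitian parts and the support function -/

/-- The Hermitian part `(z̄ A + z Aᴴ) / 2` of the matrix `z̄ A`. -/
def hermPart (A : Matrix (Fin d) (Fin d) ℂ) (z : ℂ) : Matrix (Fin d) (Fin d) ℂ :=
  (1 / 2 : ℂ) • (conj z • A + z • Aᴴ)

theorem hermPart_isHermitian (A : Matrix (Fin d) (Fin d) ℂ) (z : ℂ) :
    (hermPart A z).IsHermitian := by
  simp [hermPart, Matrix.IsHermitian, Matrix.conjTranspose_add, Matrix.conjTranspose_smul, add_comm]

theorem inner_conjTranspose (A : Matrix (Fin d) (Fin d) ℂ) (x : EuclideanSpace ℂ (Fin d)) :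
    inner ℂ x (toEuclideanLin Aᴴ x) = conj (inner ℂ x (toEuclideanLin A x)) := by
  rw [Matrix.toEuclideanLin_conjTranspose_eq_adjoint, LinearMap.adjoint_inner_right,
    inner_conj_symm]

theorem inner_hermPart (A : Matrix (Fin d) (Fin d) ℂ) (z : ℂ) (x : EuclideanSpace ℂ (Fin d)) :
    inner ℂ x (toEuclideanLin (hermPart A z) x)
      = (((conj z * inner ℂ x (toEuclideanLin A x)).re : ℝ) : ℂ) := by
  simp only [hermPart, map_smul, map_add, LinearMap.smul_apply, LinearMap.add_apply,
    inner_smul_right, inner_add_right, inner_conjTranspose]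
  rw [Complex.re_eq_add_conj]
  simp only [map_mul, Complex.conj_conj]
  ring

theorem numericalRange_smul (c : ℂ) (A : Matrix (Fin d) (Fin d) ℂ) :
    numericalRange (c • A) = (fun z => c * z) '' numericalRange A := by
  ext z
  constructor
  · rintro ⟨x, hx, rfl⟩
    exact ⟨_, ⟨x, hx, rfl⟩, by simp⟩
  · rintro ⟨_, ⟨x, hx, rfl⟩, rfl⟩
    exact ⟨x, hx, by simp⟩

theorem numericalRange_conjTranspose (A : Matrix (Fin d) (Fin d) ℂ) :
    numericalRange Aᴴ = (fun z => conj z) '' numericalRange A := by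
  ext z
  constructor
  · rintro ⟨x, hx, rfl⟩
    exact ⟨_, ⟨x, hx, rfl⟩, (inner_conjTranspose A x).symm⟩
  · rintro ⟨_, ⟨x, hx, rfl⟩, rfl⟩
    exact ⟨x, hx, (inner_conjTranspose A x).symm⟩

theorem numericalRange_eq_image (A : Matrix (Fin d) (Fin d) ℂ) :
    numericalRange A = (fun x : EuclideanSpace ℂ (Fin d) => inner ℂ x (toEuclideanLin A x)) ''
      Metric.sphere 0 1 := by
  ext z
  simp [numericalRange, eq_comm]

theorem numericalRange_isCompact (A : Matrix (Fin d) (Fin d) ℂ) :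
    IsCompact (numericalRange A) := by
  rw [numericalRange_eq_image]
  refine (isCompact_sphere _ _).image ?_
  exact continuous_id.inner (toEuclideanLin A).continuous_of_finiteDimensional

theorem numericalRange_nonempty [NeZero d] (A : Matrix (Fin d) (Fin d) ℂ) :
    (numericalRange A).Nonempty := by
  rw [numericalRange_eq_image]
  exact (NormedSpace.sphere_nonempty.2 zero_le_one).image _

theorem det_smul_one_sub_eq_zero_iff (M : Matrix (Fin d) (Fin d) ℂ) (w : ℂ) :
    (w • (1 : Matrix (Fin d) (Fin d) ℂ) - M).det = 0 ↔
      ∃ x : EuclideanSpace ℂ (Fin d), x ≠ 0 ∧ toEuclideanLin M x = w • x := by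
  rw [← Matrix.exists_mulVec_eq_zero_iff]
  constructor
  · rintro ⟨v, hv, h⟩
    refine ⟨WithLp.toLp 2 v, by simpa using hv, ?_⟩
    rw [Matrix.sub_mulVec, Matrix.smul_mulVec, Matrix.one_mulVec, sub_eq_zero] at h
    rw [Matrix.toLpLin_apply, ← h]; rfl
  · rintro ⟨x, hx, h⟩
    refine ⟨x.ofLp, by simpa using hx, ?_⟩
    rw [Matrix.sub_mulVec, Matrix.smul_mulVec, Matrix.one_mulVec, sub_eq_zero]
    have := congrArg WithLp.ofLp h
    rw [Matrix.toLpLin_apply] at this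
    simpa using this.symm

/-- A real eigenvalue of the Hermitian part of `z̄ A` is attained by `re (z̄ ·)` on the
numerical range. -/
theorem exists_mem_numericalRange_of_det_eq_zero (A : Matrix (Fin d) (Fin d) ℂ) (z : ℂ) (w : ℝ)
    (h : ((w : ℂ) • (1 : Matrix (Fin d) (Fin d) ℂ) - hermPart A z).det = 0) :
    ∃ v ∈ numericalRange A, (conj z * v).re = w := by
  obtain ⟨x, hx, hxw⟩ := (det_smul_one_sub_eq_zero_iff _ _).1 h
  have hn : ‖x‖ ≠ 0 := norm_ne_zero_iff.2 hx
  set y : EuclideanSpace ℂ (Fin d) := ((‖x‖⁻¹ : ℝ) : ℂ) • x with hy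
  have hyn : ‖y‖ = 1 := by
    rw [hy, norm_smul, Complex.norm_real, norm_inv, norm_norm, inv_mul_cancel₀ hn]
  refine ⟨_, ⟨y, hyn, rfl⟩, ?_⟩
  have h1 := inner_hermPart A z y
  have h2 : toEuclideanLin (hermPart A z) y = (w : ℂ) • y := by
    rw [hy, map_smul, hxw, smul_comm]
  rw [h2, inner_smul_right, inner_self_eq_norm_sq_to_K, hyn] at h1
  have := congrArg Complex.re h1
  simpa using this.symm

/-- The support function of the numerical range is an eigenvalue of the Hermitian part. -/
theorem exists_isGreatest_and_det_eq_zero [NeZero d] (A : Matrix (Fin d) (Fin d) ℂ) (z : ℂ) :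
    ∃ l : ℝ, IsGreatest ((fun v : ℂ => (conj z * v).re) '' numericalRange A) l ∧
      ((l : ℂ) • (1 : Matrix (Fin d) (Fin d) ℂ) - hermPart A z).det = 0 := by
  set T := toEuclideanLin (hermPart A z) with hT
  have hsym : T.IsSymmetric := by
    have := hermPart_isHermitian A z
    exact (Matrix.isSymmetric_toEuclideanLin_iff).2 this
  let T' := hsym.toSelfAdjoint
  have hT'x : ∀ x, (T' : EuclideanSpace ℂ (Fin d) →L[ℂ] EuclideanSpace ℂ (Fin d)) x = T x :=
    fun x => rfl
  have hre : ∀ x, (T' : EuclideanSpace ℂ (Fin d) →L[ℂ] EuclideanSpace ℂ (Fin d)).reApplyInnerSelf x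
      = (conj z * inner ℂ x (toEuclideanLin A x)).re := by
    intro x
    rw [ContinuousLinearMap.reApplyInnerSelf_apply, hT'x, ← inner_conj_symm, hT, inner_hermPart]
    simp
  obtain ⟨x, hx, hmax⟩ := (isCompact_sphere (0 : EuclideanSpace ℂ (Fin d)) 1).exists_isMaxOn
    (NormedSpace.sphere_nonempty.2 zero_le_one) (T'.1.reApplyInnerSelf_continuous.continuousOn)
  have hx1 : ‖x‖ = 1 := by simpa using hx
  have hx0 : x ≠ 0 := by rw [← norm_ne_zero_iff, hx1]; exact one_ne_zero
  have hev := IsSelfAdjoint.eq_smul_self_of_isLocalExtrOn T'.2 (x₀ := x)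
    (Or.inr (by rw [hx1]; exact hmax.localize))
  have hray : T'.1.rayleighQuotient x = T'.1.reApplyInnerSelf x := by
    simp [ContinuousLinearMap.rayleighQuotient, hx1]
  refine ⟨T'.1.reApplyInnerSelf x, ⟨⟨_, ⟨x, hx1, rfl⟩, (hre x).symm⟩, ?_⟩, ?_⟩
  · rintro _ ⟨_, ⟨y, hy, rfl⟩, rfl⟩
    have := hmax (show y ∈ Metric.sphere 0 1 by simpa using hy)
    simp only [Set.mem_ofPred_eq] at this
    rw [hre y] at this
    exact this
  · rw [det_smul_one_sub_eq_zero_iff]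
    refine ⟨x, hx0, ?_⟩
    rw [hray] at hev
    exact hev

/-! ### Convexity and comparison of numerical ranges -/

/-- **Toeplitz–Hausdorff theorem**: the numerical range is convex. -/
theorem numericalRange_convex (A : Matrix (Fin d) (Fin d) ℂ) : Convex ℝ (numericalRange A) := by
  rw [convex_iff_segment_subset]
  rintro _ ⟨x, hx, rfl⟩ _ ⟨y, hy, rfl⟩
  set T := toEuclideanLin A with hT
  set a := inner ℂ x (T x) with ha
  set b := inner ℂ y (T y) with hb
  rcases eq_or_ne a b with hab | hab
  · rw [← hab, segment_same]
    rintro _ rfl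
    exact ⟨x, hx, rfl⟩
  have hba : b - a ≠ 0 := sub_ne_zero.2 hab.symm
  -- the affinely normalised form takes the values `0` at `x` and `1` at `y`
  let S : EuclideanSpace ℂ (Fin d) →ₗ[ℂ] EuclideanSpace ℂ (Fin d) :=
    (b - a)⁻¹ • (T - a • LinearMap.id)
  have hS : ∀ v, inner ℂ v (S v) = (b - a)⁻¹ * (inner ℂ v (T v) - a * (‖v‖ : ℂ) ^ 2) := by
    intro v
    simp only [S, LinearMap.smul_apply, LinearMap.sub_apply, LinearMap.id_apply,
      inner_smul_right, inner_sub_right, inner_self_eq_norm_sq_to_K]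
    rfl
  have hSx : inner ℂ x (S x) = 0 := by rw [hS, hx, ← ha]; simp
  have hSy : inner ℂ y (S y) = 1 := by
    rw [hS, hy, ← hb]; simp [inv_mul_cancel₀ hba]
  -- The imaginary part of the cross terms is `Im(m r)` with `r = q - conj p`, so the phase of `conj
  -- r` kills it.
  obtain ⟨m, hm, him⟩ : ∃ m : ℂ, ‖m‖ = 1 ∧
      (conj m * inner ℂ x (S y) + m * inner ℂ y (S x)).im = 0 := by
    set p := inner ℂ x (S y)
    set q := inner ℂ y (S x)
    set r := q - conj p with hr
    have key : ∀ m : ℂ, (conj m * p + m * q).im = (m * r).im := by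
      intro m
      simp [hr]
      ring
    rcases eq_or_ne r 0 with h0 | h0
    · exact ⟨1, by simp, by rw [key, h0]; simp⟩
    · have hr0 : (‖r‖ : ℂ) ≠ 0 := by simpa using h0
      refine ⟨conj r / ‖r‖, by simp [h0], ?_⟩
      rw [key, div_mul_eq_mul_div, ← Complex.normSq_eq_conj_mul_self, ← Complex.ofReal_div]
      exact Complex.ofReal_im _
  -- a path of vectors from `x` to `y` along which the form is real
  let v : ℝ → EuclideanSpace ℂ (Fin d) := fun s => ((1 - s : ℝ) : ℂ) • m • x + (s : ℂ) • y
  have hmm : conj m * m = 1 := by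
    rw [← Complex.normSq_eq_conj_mul_self, Complex.normSq_eq_norm_sq, hm]; simp
  have hv : ∀ s, inner ℂ (v s) (S (v s)) =
      ((s * (1 - s) : ℝ) : ℂ) * (conj m * inner ℂ x (S y) + m * inner ℂ y (S x)) + (s : ℂ) ^ 2 := by
    intro s
    simp only [v, map_add, map_smul, inner_add_left, inner_add_right, inner_smul_left,
      inner_smul_right, hSx, hSy, Complex.conj_ofReal]
    push_cast
    ring
  -- If `v s = 0`, then `s y` is a multiple of `x`, where the form vanishes, while its value at `s
  -- y` is `s²`; hence `s = 0` and `m x = 0`.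
  have hv0 : ∀ s, v s ≠ 0 := by
    intro s h
    have hm0 : m ≠ 0 := by rw [← norm_ne_zero_iff, hm]; exact one_ne_zero
    have hx0 : x ≠ 0 := by rw [← norm_ne_zero_iff, hx]; exact one_ne_zero
    have e1 : (s : ℂ) • y = -(((1 - s : ℝ) : ℂ) • m • x) := eq_neg_of_add_eq_zero_right h
    have e2 : inner ℂ ((s : ℂ) • y) (S ((s : ℂ) • y)) = 0 := by
      rw [e1]
      simp [inner_smul_left, inner_smul_right, hSx]
    simp only [map_smul, inner_smul_left, inner_smul_right, hSy, Complex.conj_ofReal] at e2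
    have hs : s = 0 := by simpa using e2
    rw [hs] at h
    simp [v, hm0, hx0] at h
  let f : ℝ → ℝ := fun s => (inner ℂ (v s) (S (v s))).re / ‖v s‖ ^ 2
  have hvc : Continuous v := by
    simp only [v]
    fun_prop
  have hfc : Continuous f := by
    refine Continuous.div ?_ (hvc.norm.pow 2) (fun s => pow_ne_zero 2 (norm_ne_zero_iff.2 (hv0 s)))
    exact Complex.continuous_re.comp
      (hvc.inner ((S.continuous_of_finiteDimensional).comp hvc))
  have hf0 : f 0 = 0 := by simp [f, hv]
  have hf1 : f 1 = 1 := by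
    simp only [f, hv]
    simp [v, hy]
  rw [segment_eq_image]
  rintro _ ⟨t, ht, rfl⟩
  obtain ⟨s, -, hs⟩ := intermediate_value_Icc (zero_le_one' ℝ) hfc.continuousOn
    (show t ∈ Set.Icc (f 0) (f 1) by rw [hf0, hf1]; exact ht)
  have hn : ‖v s‖ ≠ 0 := norm_ne_zero_iff.2 (hv0 s)
  have hnc : (‖v s‖ : ℂ) ≠ 0 := by exact_mod_cast hn
  refine ⟨((‖v s‖⁻¹ : ℝ) : ℂ) • v s, by
    rw [norm_smul, Complex.norm_real, norm_inv, norm_norm, inv_mul_cancel₀ hn], ?_⟩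
  have hreal : inner ℂ (v s) (S (v s)) = ((t * ‖v s‖ ^ 2 : ℝ) : ℂ) := by
    apply Complex.ext
    · rw [← hs, Complex.ofReal_re]
      simp only [f]
      field_simp
    · rw [hv, Complex.ofReal_im, Complex.add_im, Complex.im_ofReal_mul, him]
      simp [← Complex.ofReal_pow]
  rw [hS] at hreal
  have hTv : inner ℂ (v s) (T (v s)) = ((b - a) * t + a) * (‖v s‖ : ℂ) ^ 2 := by
    rw [inv_mul_eq_iff_eq_mul₀ hba] at hreal
    push_cast at hreal
    linear_combination hreal
  rw [← hT]
  simp only [map_smul, inner_smul_left, inner_smul_right, Complex.conj_ofReal, hTv,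
    Complex.real_smul]
  push_cast
  field_simp
  ring

/-- Compact convex sets are determined by their support functions. -/
theorem subset_of_support_le {S S' : Set ℂ} (hc : Convex ℝ S') (hS' : IsClosed S')
    (h : ∀ z : ℂ, ‖z‖ = 1 → ∀ v ∈ S, ∃ v' ∈ S', (conj z * v).re ≤ (conj z * v').re) :
    S ⊆ S' := by
  intro v hv
  by_contra hv'
  obtain ⟨f, u, hu, huv⟩ := geometric_hahn_banach_closed_point hc hS' hv'
  obtain ⟨y, hy⟩ : ∃ y : ℂ, ∀ w, f w = (conj y * w).re := by
    refine ⟨⟨f 1, f Complex.I⟩, fun w => ?_⟩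
    have : w = w.re • (1 : ℂ) + w.im • Complex.I := by
      apply Complex.ext <;> simp
    conv_lhs => rw [this, map_add, map_smul, map_smul]
    simp
    ring
  have hy0 : y ≠ 0 := by
    rintro rfl
    obtain ⟨v', hv', -⟩ := h 1 (by simp) v hv
    have := hu v' hv'
    simp only [hy] at this huv
    simp at this huv
    linarith
  have hny : (0 : ℝ) < ‖y‖ := norm_pos_iff.2 hy0
  obtain ⟨v', hv', hle⟩ := h (((‖y‖⁻¹ : ℝ) : ℂ) * y)
    (by rw [norm_mul, Complex.norm_real, norm_inv, norm_norm, inv_mul_cancel₀ hny.ne']) v hv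
  have h1 := hu v' hv'
  simp only [map_mul, Complex.conj_ofReal, mul_assoc, Complex.re_ofReal_mul] at hle
  rw [hy] at h1 huv
  have := le_of_mul_le_mul_left hle (inv_pos.2 hny)
  linarith

/-- An eigenvalue of `hermPart B z` equal to the support function of `W(A)` is attained on `W(B)`,
so `W(B)` reaches at least as far in direction `z`. -/
theorem numericalRange_subset_of_det [NeZero d] {A B : Matrix (Fin d) (Fin d) ℂ}
    (h : ∀ (z : ℂ) (w : ℝ), ‖z‖ = 1 →
      ((w : ℂ) • (1 : Matrix (Fin d) (Fin d) ℂ) - hermPart A z).det = 0 →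
      ((w : ℂ) • (1 : Matrix (Fin d) (Fin d) ℂ) - hermPart B z).det = 0) :
    numericalRange A ⊆ numericalRange B := by
  refine subset_of_support_le (numericalRange_convex B) (numericalRange_isCompact B).isClosed ?_
  intro z hz v hv
  obtain ⟨l, hl, hdet⟩ := exists_isGreatest_and_det_eq_zero A z
  obtain ⟨v', hv', hl'⟩ := exists_mem_numericalRange_of_det_eq_zero B z l (h z l hz hdet)
  exact ⟨v', hv', hl'.symm ▸ hl.2 ⟨v, hv, rfl⟩⟩

/-! ### Common divisors of monic polynomials -/

/-- Two monic polynomials over an integrally closed domain have a common monic divisor which is a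
linear combination of them up to a nonzero constant. -/
theorem exists_monic_common_dvd_bezout {R : Type*} [CommRing R] [IsDomain R]
    [IsIntegrallyClosed R] {f g : R[X]} (hf : f.Monic) (hg : g.Monic) :
    ∃ p : R[X], p.Monic ∧ p ∣ f ∧ p ∣ g ∧
      ∃ (s : R) (a b : R[X]), s ≠ 0 ∧ C s * p = a * f + b * g := by
  classical
  let K := FractionRing R
  let φ := algebraMap R K
  have hφ : Function.Injective φ := IsFractionRing.injective R K
  set h := EuclideanDomain.gcd (f.map φ) (g.map φ) with hh
  have hhf : h ∣ f.map φ := EuclideanDomain.gcd_dvd_left _ _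
  have hhg : h ∣ g.map φ := EuclideanDomain.gcd_dvd_right _ _
  have hh0 : h ≠ 0 := ne_zero_of_dvd_ne_zero (hf.map φ).ne_zero hhf
  have hl : h.leadingCoeff ≠ 0 := leadingCoeff_ne_zero.2 hh0
  -- Gauss's lemma: up to its leading coefficient, a divisor of `f` over the fraction field already
  -- has coefficients in `R`.
  obtain ⟨p, hp⟩ := IsIntegrallyClosed.eq_map_mul_C_of_dvd K hf hhf
  have hpl : φ p.leadingCoeff = 1 := by
    have := congrArg leadingCoeff hp
    rw [leadingCoeff_mul, leadingCoeff_C, leadingCoeff_map_of_injective hφ] at this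
    exact mul_right_cancel₀ hl (by rw [this, one_mul])
  have hpm : p.Monic := hφ (by rw [hpl, map_one])
  obtain ⟨c, hc⟩ : ∃ c, c = h.leadingCoeff := ⟨_, rfl⟩
  rw [← hc] at hp hl
  have hpd : p.map φ ∣ h := ⟨_, hp.symm⟩
  refine ⟨p, hpm, hf.dvd_of_fraction_map_dvd_fraction_map (K := K) hpm (hpd.trans hhf),
    hg.dvd_of_fraction_map_dvd_fraction_map (K := K) hpm (hpd.trans hhg), ?_⟩
  have hbez := EuclideanDomain.gcd_eq_gcd_ab (f.map φ) (g.map φ)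
  rw [← hh] at hbez
  set x := EuclideanDomain.gcdA (f.map φ) (g.map φ)
  set y := EuclideanDomain.gcdB (f.map φ) (g.map φ)
  have hpx : p.map φ = C c⁻¹ * x * f.map φ + C c⁻¹ * y * g.map φ := by
    have : p.map φ = C c⁻¹ * h := by
      rw [← hp, mul_left_comm, ← C_mul, inv_mul_cancel₀ hl, C_1, mul_one]
    rw [this, hbez]
    ring
  obtain ⟨s, hs, hsx⟩ := IsLocalization.integerNormalization_spec (nonZeroDivisors R)
    (C c⁻¹ * x)
  obtain ⟨t, ht, hty⟩ := IsLocalization.integerNormalization_spec (nonZeroDivisors R)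
    (C c⁻¹ * y)
  set a := IsLocalization.integerNormalization (nonZeroDivisors R) (C c⁻¹ * x)
  set b := IsLocalization.integerNormalization (nonZeroDivisors R) (C c⁻¹ * y)
  refine ⟨s * t, C t * a, C s * b, mul_ne_zero (nonZeroDivisors.ne_zero hs)
    (nonZeroDivisors.ne_zero ht), ?_⟩
  apply Polynomial.map_injective φ hφ
  have e1 : a.map φ = C (φ s) * (C c⁻¹ * x) := by
    rw [hsx, Algebra.smul_def]; rfl
  have e2 : b.map φ = C (φ t) * (C c⁻¹ * y) := by
    rw [hty, Algebra.smul_def]; rfl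
  simp only [Polynomial.map_mul, Polynomial.map_add, map_C, e1, e2, hpx, map_mul]
  ring

/-! ### Total degree of bivariate polynomials -/

section TotalDegree

variable {R : Type*} [CommRing R]

/-- The substitution `X ↦ T X`, `Y ↦ T` in bivariate polynomials. The degree in `T` of the image
is the total degree. -/
def dilate : R[X][X] →+* R[X][X] :=
  eval₂RingHom (eval₂RingHom (C.comp C) (C X * X)) X

/-- The monomial `X^a Y^b` goes to `X^a T^(a+b)`; keeping `X` prevents distinct monomials from
cancelling. -/
theorem dilate_coeff (f : R[X][X]) (a b : ℕ) :
    ((dilate f).coeff (a + b)).coeff a = (f.coeff b).coeff a := by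
  induction f using Polynomial.induction_on' with
  | add p q hp hq => simp [hp, hq]
  | monomial n p =>
    induction p using Polynomial.induction_on' with
    | add p q hp hq => simp only [map_add, coeff_add, hp, hq]
    | monomial k r =>
      have h : dilate (monomial n (monomial k r)) = monomial (k + n) (monomial k r) := by
        simp only [dilate, coe_eval₂RingHom, eval₂_monomial, RingHom.comp_apply]
        simp only [← C_mul_X_pow_eq_monomial, map_mul, map_pow]
        ring
      rw [h]
      simp only [coeff_monomial]
      by_cases hk : k = a
      · subst hk
        by_cases hn : n = b
        · simp [hn]
        · simp [hn]
      · by_cases hn : n = b <;> by_cases hkn : k + n = a + b <;>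
          simp [hn, hkn, coeff_monomial, hk]

theorem add_le_of_dilate_natDegree_le {f : R[X][X]} {m : ℕ} (h : (dilate f).natDegree ≤ m)
    {a b : ℕ} (hab : (f.coeff b).coeff a ≠ 0) : a + b ≤ m := by
  refine le_trans (le_natDegree_of_ne_zero fun h0 => hab ?_) h
  rw [← dilate_coeff, h0, coeff_zero]

theorem natDegree_le_natDegree_dilate [Nontrivial R] {f : R[X][X]} (hf : f.Monic) :
    f.natDegree ≤ (dilate f).natDegree := by
  refine le_natDegree_of_ne_zero fun h0 => ?_
  have := dilate_coeff f 0 f.natDegree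
  rw [zero_add, h0, coeff_natDegree, hf.leadingCoeff] at this
  simp at this

/-- If a monic bivariate polynomial has total degree equal to its degree, so do its monic
divisors. -/
theorem natDegree_dilate_le_of_dvd [IsDomain R] {f g : R[X][X]} (hf : f.Monic) (hg : g.Monic)
    (hfd : (dilate f).natDegree ≤ f.natDegree) (hgf : g ∣ f) :
    (dilate g).natDegree ≤ g.natDegree := by
  obtain ⟨h, rfl⟩ := hgf
  have hh : h.Monic := hg.of_mul_monic_left hf
  have key : ∀ {p : R[X][X]}, p.Monic → dilate p ≠ 0 := by
    intro p hp h0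
    have := dilate_coeff p 0 p.natDegree
    rw [h0, coeff_natDegree, hp.leadingCoeff] at this
    simp at this
  -- Degrees in `T` and in `Y` are both additive, and the former dominates on each factor, so
  -- equality for the product forces it for `g`.
  rw [map_mul, natDegree_mul (key hg) (key hh), hg.natDegree_mul hh] at hfd
  have := natDegree_le_natDegree_dilate hh
  omega

end TotalDegree

/-! ### Restriction to the curves `x ↦ (x², l x)` -/

section Twist

/-- The polynomial `x ↦ G (x ^ 2, l x)`. -/
def twist (l : ℂ) : ℂ[X][X] →+* ℂ[X] :=
  eval₂RingHom (expand ℂ 2 : ℂ[X] →ₐ[ℂ] ℂ[X]).toRingHom (C l * X)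

theorem twist_eq_sum (l : ℂ) (G : ℂ[X][X]) :
    twist l G = ∑ b ∈ Finset.range (G.natDegree + 1),
      C (l ^ b) * (expand ℂ 2 (G.coeff b) * X ^ b) := by
  rw [twist, coe_eval₂RingHom, eval₂_eq_sum_range]
  refine Finset.sum_congr rfl fun b _ => ?_
  rw [mul_pow, C_pow]
  change expand ℂ 2 (G.coeff b) * (C l ^ b * X ^ b) = _
  ring

theorem twist_eval (l x : ℂ) (G : ℂ[X][X]) :
    (twist l G).eval x = (G.map (evalRingHom (x ^ 2))).eval (x * l) := by
  rw [twist, coe_eval₂RingHom, eval_map, ← coe_evalRingHom, hom_eval₂]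
  congr 1
  · ext <;> simp
  · rw [coe_evalRingHom, eval_mul, eval_C, eval_X, mul_comm]

theorem natDegree_twist_le {G : ℂ[X][X]} (hG : (dilate G).natDegree ≤ G.natDegree) (l : ℂ) :
    (twist l G).natDegree ≤ 2 * G.natDegree := by
  rw [twist_eq_sum]
  refine natDegree_sum_le_of_forall_le _ _ fun b hb => ?_
  refine (natDegree_C_mul_le _ _).trans (natDegree_mul_le.trans ?_)
  rw [natDegree_expand, natDegree_X_pow]
  rcases eq_or_ne (G.coeff b) 0 with h | h
  · rw [h, natDegree_zero]; simp at hb; omega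
  · have := add_le_of_dilate_natDegree_le hG (a := (G.coeff b).natDegree) (b := b)
      (by rw [coeff_natDegree]; exact leadingCoeff_ne_zero.2 h)
    omega

/-- The coefficient of `x ^ m` in `G (x ^ 2, l x)` as a polynomial in `l`. -/
def twistCoeff (G : ℂ[X][X]) (m : ℕ) : ℂ[X] :=
  ∑ b ∈ Finset.range (m + 1), C ((expand ℂ 2 (G.coeff b)).coeff (m - b)) * X ^ b

theorem twistCoeff_eval (G : ℂ[X][X]) (l : ℂ) :
    (twistCoeff G G.natDegree).eval l = (twist l G).coeff G.natDegree := by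
  rw [twist_eq_sum, finsetSum_coeff, twistCoeff, eval_finsetSum]
  refine Finset.sum_congr rfl fun b hb => ?_
  rw [coeff_C_mul, coeff_mul_X_pow', if_pos (by simp at hb; omega), eval_mul, eval_C,
    eval_pow, eval_X, mul_comm]

/-- The top monomial `Y^m` contributes `l^m` with coefficient `1`, and the other terms carry lower
powers of `l`. -/
theorem twistCoeff_ne_zero {G : ℂ[X][X]} (hG : G.Monic) : twistCoeff G G.natDegree ≠ 0 := by
  intro h
  have := congrArg (fun p => coeff p G.natDegree) h
  simp only [twistCoeff, finsetSum_coeff, coeff_C_mul, coeff_X_pow, coeff_zero] at this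
  rw [Finset.sum_eq_single G.natDegree] at this
  · simp [hG.coeff_natDegree] at this
  · intro b _ hb
    simp [hb.symm]
  · simp

/-- A polynomial of degree less than `m + d` vanishing at the `d` points `ω ^ k z` has no term of
degree `m < d`. -/
theorem coeff_eq_zero_of_eval_rotations {d m : ℕ} {w z : ℂ} (hw : IsPrimitiveRoot w d)
    (hz : z ≠ 0) (hm : m < d) {q : ℂ[X]} (hq : q.natDegree < m + d)
    (h : ∀ k < d, q.eval (w ^ k * z) = 0) : q.coeff m = 0 := by
  have hsum : ∀ j : ℕ, ¬ d ∣ j → ∑ k ∈ Finset.range d, (w ^ j) ^ k = 0 := by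
    intro j hj
    have h1 : w ^ j - 1 ≠ 0 := fun h0 => hj ((hw.pow_eq_one_iff_dvd j).1 (sub_eq_zero.1 h0))
    have h2 := mul_geom_sum (w ^ j) d
    rw [← pow_mul, mul_comm j d, pow_mul, hw.pow_eq_one, one_pow, sub_self] at h2
    exact (mul_eq_zero.1 h2).resolve_left h1
  -- A discrete Fourier sum, with `d - m` standing for `-m`, isolates exponents congruent to `m`
  -- modulo `d`; below `m + d` only `m` itself qualifies.
  have h0 : ∑ k ∈ Finset.range d, (w ^ k) ^ (d - m) * q.eval (w ^ k * z) = 0 :=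
    Finset.sum_eq_zero fun k hk => by rw [h k (Finset.mem_range.1 hk), mul_zero]
  have h3 : ∑ k ∈ Finset.range d, (w ^ k) ^ (d - m) * q.eval (w ^ k * z)
      = ∑ n ∈ Finset.range (m + d), q.coeff n * z ^ n *
          ∑ k ∈ Finset.range d, (w ^ (n + (d - m))) ^ k := by
    simp_rw [eval_eq_sum_range' hq, Finset.mul_sum]
    rw [Finset.sum_comm]
    refine Finset.sum_congr rfl fun n _ => Finset.sum_congr rfl fun k _ => ?_
    rw [mul_pow, ← pow_mul, ← pow_mul, ← pow_mul]
    ring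
  rw [h0, Finset.sum_eq_single m] at h3
  · rw [Nat.add_sub_cancel' hm.le, hw.pow_eq_one] at h3
    have hd : (d : ℂ) ≠ 0 := by exact_mod_cast (by omega : d ≠ 0)
    simpa [hd, hz] using h3.symm
  · intro n hn hnm
    rw [hsum, mul_zero]
    rintro ⟨c, hc⟩
    rw [Finset.mem_range] at hn
    have hc1 : c < 2 := by
      by_contra! hc2
      have := Nat.mul_le_mul_left d hc2
      omega
    interval_cases c <;> omega
  · intro hmn
    simp at hmn
    omega

end Twist

/-! ### The determinantal pencil -/

/-- The polynomial `det (Y - (A + X Aᴴ) / 2)`. -/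
def pencilPoly (A : Matrix (Fin d) (Fin d) ℂ) : ℂ[X][X] :=
  (((1 / 2 : ℂ) • A).map C + (X : ℂ[X]) • ((1 / 2 : ℂ) • Aᴴ).map C).charpoly

theorem pencilPoly_monic (A : Matrix (Fin d) (Fin d) ℂ) : (pencilPoly A).Monic :=
  charpoly_monic _

theorem pencilPoly_natDegree (A : Matrix (Fin d) (Fin d) ℂ) : (pencilPoly A).natDegree = d := by
  rw [pencilPoly, charpoly_natDegree_eq_dim, Fintype.card_fin]

theorem pencilPoly_eval (A : Matrix (Fin d) (Fin d) ℂ) (u t : ℂ) :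
    ((pencilPoly A).map (evalRingHom u)).eval t
      = (t • (1 : Matrix (Fin d) (Fin d) ℂ) - (1 / 2 : ℂ) • (A + u • Aᴴ)).det := by
  rw [pencilPoly, ← charpoly_map, eval_charpoly]
  congr 1
  ext i j
  simp [Matrix.one_apply, Matrix.diagonal_apply]
  ring

/-- Dilation turns the matrix into `T(1 - X Aᴴ/2) - A/2`, which is affine in `T`. -/
theorem natDegree_dilate_pencilPoly_le (A : Matrix (Fin d) (Fin d) ℂ) :
    (dilate (pencilPoly A)).natDegree ≤ (pencilPoly A).natDegree := by
  have h : dilate (pencilPoly A) = det ((X : ℂ[X][X]) •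
      ((1 : Matrix (Fin d) (Fin d) ℂ[X]) - (X : ℂ[X]) • ((1 / 2 : ℂ) • Aᴴ).map C).map C
        + (-((1 / 2 : ℂ) • A).map C : Matrix (Fin d) (Fin d) ℂ[X]).map C) := by
    rw [pencilPoly, charpoly, RingHom.map_det]
    congr 1
    ext1 i j
    rcases eq_or_ne i j with rfl | hij
    · simp [dilate]
      ring
    · simp [dilate, hij]
      ring
  rw [pencilPoly_natDegree, h]
  simpa using natDegree_det_X_add_C_le
    ((1 : Matrix (Fin d) (Fin d) ℂ[X]) - (X : ℂ[X]) • ((1 / 2 : ℂ) • Aᴴ).map C)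
    (-((1 / 2 : ℂ) • A).map C : Matrix (Fin d) (Fin d) ℂ[X])

/-- On the unit circle the twisted pencil is the characteristic polynomial of the Hermitian
part. -/
theorem twist_pencilPoly_eval (A : Matrix (Fin d) (Fin d) ℂ) (w z : ℂ) (hz : ‖z‖ = 1) :
    (twist w (pencilPoly A)).eval z
      = z ^ d * (w • (1 : Matrix (Fin d) (Fin d) ℂ) - hermPart A z).det := by
  have hzz : z * conj z = 1 := by
    rw [Complex.mul_conj, Complex.normSq_eq_norm_sq, hz]; simp
  rw [twist_eval, pencilPoly_eval]
  have h := det_smul (w • (1 : Matrix (Fin d) (Fin d) ℂ) - hermPart A z) z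
  rw [Fintype.card_fin] at h
  rw [← h, smul_sub, smul_smul, hermPart, smul_comm z (1 / 2 : ℂ), smul_add (z : ℂ), smul_smul z,
    smul_smul z, hzz, one_smul, sq]

theorem twist_pencilPoly_eval_zero (A : Matrix (Fin d) (Fin d) ℂ) (w : ℂ) :
    (twist w (pencilPoly A)).eval 0 = (-1 / 2 : ℂ) ^ d * A.det := by
  rw [twist_eval, pencilPoly_eval]
  simp only [ne_eq, OfNat.ofNat_ne_zero, not_false_eq_true, zero_pow, zero_smul, add_zero,
    zero_mul, zero_sub]
  rw [← neg_smul, det_smul, Fintype.card_fin]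
  norm_num

theorem hermPart_smul (A : Matrix (Fin d) (Fin d) ℂ) (c z : ℂ) :
    hermPart (c • A) z = hermPart A (conj c * z) := by
  simp only [hermPart, conjTranspose_smul, smul_smul, map_mul, Complex.conj_conj]
  congr 2
  · rw [mul_comm]
  · rw [mul_comm]; rfl

theorem hermPart_conjTranspose (A : Matrix (Fin d) (Fin d) ℂ) (z : ℂ) :
    hermPart Aᴴ z = hermPart A (conj z) := by
  simp only [hermPart, conjTranspose_conjTranspose, Complex.conj_conj]
  rw [add_comm]

theorem infinite_norm_eq_one : {z : ℂ | ‖z‖ = 1}.Infinite := by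
  have h : ((fun t : ℝ => Complex.exp (t * Complex.I)) '' Set.Ioc (-Real.pi) Real.pi).Infinite := by
    refine (Set.Ioc_infinite (by linarith [Real.pi_pos])).image ?_
    intro s hs t ht hst
    have := congrArg Complex.arg hst
    simp only [Complex.exp_mul_I, Complex.arg_cos_add_sin_mul_I hs,
      Complex.arg_cos_add_sin_mul_I ht] at this
    exact this
  refine h.mono ?_
  rintro _ ⟨t, -, rfl⟩
  exact Complex.norm_exp_ofReal_mul_I t

theorem eq_of_eval_eq_of_norm_eq_one {p q : ℂ[X]} (h : ∀ z : ℂ, ‖z‖ = 1 → p.eval z = q.eval z) :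
    p = q :=
  Polynomial.eq_of_infinite_eval_eq p q (infinite_norm_eq_one.mono fun z hz => h z hz)

/-! ### Rigidity of the pencil under rotation -/

/-- If the numerical range of an invertible matrix is invariant under a rotation of order `d`, then
the whole characteristic polynomial of the pencil is. -/
theorem pencilPoly_smul_eq [NeZero d] {A : Matrix (Fin d) (Fin d) ℂ} (hA : A.det ≠ 0) {c : ℂ}
    (hc : IsPrimitiveRoot c d) (hW : numericalRange (c • A) = numericalRange A) :
    pencilPoly (c • A) = pencilPoly A := by
  by_contra hne
  have hd : d ≠ 0 := NeZero.ne d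
  have hc1 : ‖c‖ = 1 := hc.norm'_eq_one hd
  have hcc : c * conj c = 1 := by
    rw [Complex.mul_conj, Complex.normSq_eq_norm_sq, hc1]; simp
  choose l hl hldet using fun z => exists_isGreatest_and_det_eq_zero A z
  have hWc : (fun z => c * z) '' numericalRange A = numericalRange A := by
    rw [← numericalRange_smul, hW]
  -- Equal numerical ranges have equal support functions, so `l z` is a root of both characteristic
  -- polynomials.
  have hdet' : ∀ z, ((l z : ℂ) • (1 : Matrix (Fin d) (Fin d) ℂ) - hermPart (c • A) z).det = 0 := by
    intro z
    obtain ⟨l', hl', h'⟩ := exists_isGreatest_and_det_eq_zero (c • A) z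
    rw [hW] at hl'
    rwa [(hl z).unique hl']
  have hlc : ∀ z, l (c * z) = l z := by
    intro z
    have h1 := hl (c * z)
    rw [← hWc, Set.image_image] at h1
    have h2 : ∀ v, conj (c * z) * (c * v) = conj z * v := by
      intro v
      rw [map_mul]
      linear_combination conj z * v * hcc
    simp only [h2] at h1
    exact h1.unique (hl z)
  have hlck : ∀ (k : ℕ) z, l (c ^ k * z) = l z := by
    intro k z
    induction k with
    | zero => simp
    | succ k ih => rw [pow_succ', mul_assoc, hlc, ih]
  obtain ⟨G, hG, hGF, hGF', s, a, b, hs, hbez⟩ :=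
    exists_monic_common_dvd_bezout (pencilPoly_monic (c • A)) (pencilPoly_monic A)
  have hdeg : G.natDegree < d := by
    by_contra! hle
    have h1 := eq_of_monic_of_dvd_of_natDegree_le hG (pencilPoly_monic _) hGF
      ((pencilPoly_natDegree _).le.trans hle)
    have h2 := eq_of_monic_of_dvd_of_natDegree_le hG (pencilPoly_monic _) hGF'
      ((pencilPoly_natDegree _).le.trans hle)
    exact hne (h1.trans h2.symm)
  have hGdil := natDegree_dilate_le_of_dvd (pencilPoly_monic A) hG
    (natDegree_dilate_pencilPoly_le A) hGF'
  have hGzero : ∀ z, ‖z‖ = 1 → s.eval (z ^ 2) ≠ 0 → (twist (l z) G).eval z = 0 := by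
    intro z hz hsz
    have h1 := congrArg (fun p => (twist (l z) p).eval z) hbez
    simp only [map_mul, map_add, eval_mul, eval_add, twist_pencilPoly_eval _ _ z hz, hldet,
      hdet', mul_zero, add_zero] at h1
    refine (mul_eq_zero.1 h1).resolve_left ?_
    rw [twist_eval, map_C, eval_C]
    exact hsz
  -- the points of the circle at which no rotation meets a zero of `s`
  let p : ℂ[X] := ∏ k ∈ Finset.range d, s.comp ((C (c ^ k) * X) ^ 2)
  have hp0 : p ≠ 0 := by
    refine Finset.prod_ne_zero_iff.2 fun k _ => ?_
    intro h0
    have hck : c ^ k ≠ 0 := pow_ne_zero _ (hc.ne_zero hd)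
    rcases comp_eq_zero_iff.1 h0 with h | ⟨-, h⟩
    · exact hs h
    · have h2 := congrArg natDegree h
      rw [natDegree_pow, natDegree_C_mul_X _ hck, natDegree_C] at h2
      norm_num at h2
  -- Because `l` is constant on the orbit of `z`, the same polynomial `twist (l z) G` vanishes at
  -- all `d` rotated points.
  have hQ : ∀ z, ‖z‖ = 1 → p.eval z ≠ 0 →
      (twistCoeff G G.natDegree).IsRoot (l z : ℂ) := by
    intro z hz hpz
    rw [IsRoot, twistCoeff_eval]
    have hz0 : z ≠ 0 := by rw [← norm_ne_zero_iff, hz]; exact one_ne_zero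
    refine coeff_eq_zero_of_eval_rotations hc hz0 hdeg
      ((natDegree_twist_le hGdil _).trans_lt (by omega)) fun k hk => ?_
    rw [← hlck k z]
    refine hGzero _ (by rw [norm_mul, norm_pow, hc1, hz]; simp) ?_
    have := Finset.prod_ne_zero_iff.1 (by rwa [eval_prod] at hpz) k (Finset.mem_range.2 hk)
    simpa using this
  have hinf : ({z : ℂ | ‖z‖ = 1} \ {z | p.IsRoot z}).Infinite :=
    infinite_norm_eq_one.sdiff (finite_setOfPred_isRoot hp0)
  -- Pigeonhole: infinitely many `z`, but `l z` lies in a finite root set.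
  obtain ⟨r, hr⟩ : ∃ r : ℂ, {z : ℂ | ‖z‖ = 1 ∧ (l z : ℂ) = r}.Infinite := by
    by_contra! hfin
    refine hinf (Set.Finite.subset ((finite_setOfPred_isRoot (twistCoeff_ne_zero hG)).biUnion
      fun r _ => hfin r) ?_)
    rintro z ⟨hz, hpz⟩
    exact Set.mem_biUnion (show (l z : ℂ) ∈ _ from hQ z hz hpz) ⟨hz, rfl⟩
  have hzero : twist r (pencilPoly A) = 0 := by
    refine eq_zero_of_infinite_isRoot _ (hr.mono ?_)
    rintro z ⟨hz, rfl⟩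
    change (twist _ _).eval z = 0
    rw [twist_pencilPoly_eval _ _ _ hz, hldet, mul_zero]
  have h0 := twist_pencilPoly_eval_zero A r
  rw [hzero, eval_zero] at h0
  exact mul_ne_zero (pow_ne_zero _ (by norm_num)) hA h0.symm

theorem det_hermPart_rotate [NeZero d] {A : Matrix (Fin d) (Fin d) ℂ} (hA : A.det ≠ 0) {c : ℂ}
    (hc : IsPrimitiveRoot c d) (hW : numericalRange (c • A) = numericalRange A) (w : ℂ) {z : ℂ}
    (hz : ‖z‖ = 1) :
    (w • (1 : Matrix (Fin d) (Fin d) ℂ) - hermPart A (c * z)).det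
      = (w • (1 : Matrix (Fin d) (Fin d) ℂ) - hermPart A z).det := by
  have hc1 : ‖c‖ = 1 := hc.norm'_eq_one (NeZero.ne d)
  have hcc : conj c * c = 1 := by
    rw [← Complex.normSq_eq_conj_mul_self, Complex.normSq_eq_norm_sq, hc1]; simp
  have hcz : ‖c * z‖ = 1 := by rw [norm_mul, hc1, hz, one_mul]
  have hcz0 : (c * z) ^ d ≠ 0 := pow_ne_zero _ (by rw [← norm_ne_zero_iff, hcz]; exact one_ne_zero)
  have h1 := twist_pencilPoly_eval (c • A) w (c * z) hcz
  rw [pencilPoly_smul_eq hA hc hW, twist_pencilPoly_eval A w (c * z) hcz, hermPart_smul,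
    ← mul_assoc, hcc, one_mul] at h1
  exact mul_left_cancel₀ hcz0 h1

/-- With `a + b ≤ d`, the equation `2a + b = 2d` forces `a = d`, `b = 0`; the coefficient of `X^d`
is `det(-Aᴴ/2)`. -/
theorem coeff_twist_pencilPoly_two_mul (A : Matrix (Fin d) (Fin d) ℂ) (w : ℂ) :
    (twist w (pencilPoly A)).coeff (2 * d) = (-1 / 2 : ℂ) ^ d * conj A.det := by
  have hdil := natDegree_dilate_pencilPoly_le A
  rw [twist_eq_sum, finsetSum_coeff, pencilPoly_natDegree, Finset.sum_eq_single 0]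
  · have h0 : (pencilPoly A).coeff 0
        = det ((X : ℂ[X]) • ((-1 / 2 : ℂ) • Aᴴ).map C + ((-1 / 2 : ℂ) • A).map C) := by
      rw [coeff_zero_eq_eval_zero, pencilPoly, eval_charpoly, map_zero, zero_sub]
      congr 1
      ext1 i j
      simp only [Matrix.neg_apply, Matrix.add_apply, Matrix.map_apply, Matrix.smul_apply,
        smul_eq_mul, C_mul, neg_add]
      rw [show (-1 / 2 : ℂ) = -(1 / 2) by ring, C_neg]
      ring
    rw [pow_zero, C_1, one_mul, pow_zero, mul_one, mul_comm 2 d, coeff_expand_mul two_pos, h0]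
    have := coeff_det_X_add_C_card ((-1 / 2 : ℂ) • Aᴴ) ((-1 / 2 : ℂ) • A)
    rw [Fintype.card_fin] at this
    rw [this, det_smul, Fintype.card_fin, det_conjTranspose]
    rfl
  · intro b hb hb0
    simp only [Finset.mem_range] at hb
    rw [coeff_C_mul, coeff_mul_X_pow', if_pos (by omega)]
    refine mul_eq_zero_of_right _ (coeff_eq_zero_of_natDegree_lt ?_)
    rw [natDegree_expand]
    rcases eq_or_ne ((pencilPoly A).coeff b) 0 with h | h
    · rw [h, natDegree_zero]; omega
    · have := add_le_of_dilate_natDegree_le hdil (a := ((pencilPoly A).coeff b).natDegree) (b := b)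
        (by rw [coeff_natDegree]; exact leadingCoeff_ne_zero.2 h)
      rw [pencilPoly_natDegree] at this
      omega
  · simp

/-- A polynomial of degree at most `2 d` invariant under a rotation of order `d` has only three
terms. -/
theorem eval_eq_of_rotation_invariant {c : ℂ} (hd : 0 < d) (hc : IsPrimitiveRoot c d) {q : ℂ[X]}
    (hq : q.natDegree ≤ 2 * d) (h : ∀ z : ℂ, ‖z‖ = 1 → q.eval (c * z) = q.eval z) (z : ℂ) :
    q.eval z = q.coeff 0 + q.coeff d * z ^ d + q.coeff (2 * d) * z ^ (2 * d) := by
  have hcomp : q.comp (C c * X) = q :=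
    eq_of_eval_eq_of_norm_eq_one fun z hz => by simpa using h z hz
  have hcoeff : ∀ n, ¬ d ∣ n → q.coeff n = 0 := by
    intro n hn
    have h1 := congrArg (fun p => coeff p n) hcomp
    simp only [comp_C_mul_X_coeff] at h1
    have h2 : c ^ n - 1 ≠ 0 := fun h0 => hn ((hc.pow_eq_one_iff_dvd n).1 (sub_eq_zero.1 h0))
    refine (mul_eq_zero.1 (?_ : q.coeff n * (c ^ n - 1) = 0)).resolve_right h2
    linear_combination h1
  rw [eval_eq_sum_range' (Nat.lt_succ_of_le hq)]
  have hsub : ({0, d, 2 * d} : Finset ℕ) ⊆ Finset.range (2 * d + 1) := by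
    intro n hn
    simp only [Finset.mem_insert, Finset.mem_singleton] at hn
    rw [Finset.mem_range]
    omega
  rw [← Finset.sum_subset hsub]
  · rw [Finset.sum_insert (by simp; omega), Finset.sum_insert (by simp; omega),
      Finset.sum_singleton]
    ring
  · intro n hn hn'
    rw [hcoeff, zero_mul]
    rintro ⟨k, rfl⟩
    simp only [Finset.mem_insert, Finset.mem_singleton, not_or, Finset.mem_range] at hn hn'
    have hk : k < 3 := by
      by_contra! hk3
      have := Nat.mul_le_mul_left d hk3
      omega
    interval_cases k <;> omega

/-! ### Condition `(C_d)` and its consequences -/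

theorem conj_mul_self_of_norm_eq_one {c : ℂ} (hc : ‖c‖ = 1) : conj c * c = 1 := by
  rw [← Complex.normSq_eq_conj_mul_self, Complex.normSq_eq_norm_sq, hc]; simp

theorem mul_conj_self_of_norm_eq_one {c : ℂ} (hc : ‖c‖ = 1) : c * conj c = 1 := by
  rw [mul_comm, conj_mul_self_of_norm_eq_one hc]

theorem norm_eq_one_of_pow_eq (hd : d ≠ 0) {c v : ℂ} (hc : ‖c‖ = 1) (hv : v ^ d = c ^ d) :
    ‖v‖ = 1 := by
  have h := congrArg norm hv
  rw [norm_pow, norm_pow, hc, one_pow] at h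
  exact (pow_eq_one_iff_of_nonneg (norm_nonneg v) hd).1 h

theorem conditionC_iff (A : Matrix (Fin d) (Fin d) ℂ) :
    ConditionC A ↔ ∃ P : ℝ[X], ∀ z : ℂ, ‖z‖ = 1 → ∀ w : ℂ,
      (w • (1 : Matrix (Fin d) (Fin d) ℂ) - hermPart A z).det
        = aeval w P - (((-1 / 2 : ℝ) ^ (d - 1) * (conj z ^ d * A.det).re : ℝ) : ℂ) := by
  have hconj : ∀ θ : ℝ, conj (Complex.exp (θ * Complex.I)) = Complex.exp (-(θ * Complex.I)) := by
    intro θ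
    rw [← Complex.exp_conj]
    simp
  have hpow : ∀ θ : ℝ, Complex.exp (-((d : ℂ) * θ * Complex.I))
      = conj (Complex.exp (θ * Complex.I)) ^ d := by
    intro θ
    rw [hconj, ← Complex.exp_nat_mul]
    congr 1
    ring
  unfold ConditionC
  refine exists_congr fun P => ⟨fun h z hz w => ?_, fun h θ w => ?_⟩
  · have hz' : z = Complex.exp ((Complex.arg z : ℝ) * Complex.I) := by
      conv_lhs => rw [← Complex.norm_mul_exp_arg_mul_I z, hz]
      simp
    have := h (Complex.arg z) w
    rw [hpow, ← hconj, ← hz'] at this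
    exact this
  · have := h _ (Complex.norm_exp_ofReal_mul_I θ) w
    rw [hpow, ← hconj]
    exact this

/-- This supplies the reality of the polynomial `P` in `(C_d)`: evaluating at the single direction
`z = 1` suffices. -/
theorem exists_real_charpoly (A : Matrix (Fin d) (Fin d) ℂ) :
    ∃ P : ℝ[X], ∀ w : ℂ,
      (w • (1 : Matrix (Fin d) (Fin d) ℂ) - hermPart A 1).det = aeval w P := by
  have h := hermPart_isHermitian A 1
  refine ⟨∏ i, (X - C (h.eigenvalues i)), fun w => ?_⟩
  have h1 := congrArg (fun p => p.eval w) h.charpoly_eq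
  rw [eval_charpoly] at h1
  rw [show w • (1 : Matrix (Fin d) (Fin d) ℂ) = Matrix.scalar (Fin d) w by
    ext i j; simp [Matrix.one_apply, Matrix.diagonal_apply], h1]
  simp [eval_prod, map_prod]

theorem ConditionC.of_det_rotate (hd : 0 < d) {A : Matrix (Fin d) (Fin d) ℂ} {c : ℂ}
    (hc : IsPrimitiveRoot c d)
    (h : ∀ w z : ℂ, ‖z‖ = 1 → (w • (1 : Matrix (Fin d) (Fin d) ℂ) - hermPart A (c * z)).det
      = (w • (1 : Matrix (Fin d) (Fin d) ℂ) - hermPart A z).det) : ConditionC A := by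
  have hc1 : ‖c‖ = 1 := hc.norm'_eq_one hd.ne'
  have hform : ∀ z : ℂ, ‖z‖ = 1 → ∀ w : ℂ,
      (w • (1 : Matrix (Fin d) (Fin d) ℂ) - hermPart A z).det
        = (twist w (pencilPoly A)).coeff d
          - (((-1 / 2 : ℝ) ^ (d - 1) * (conj z ^ d * A.det).re : ℝ) : ℂ) := by
    intro z hz w
    have hdeg := natDegree_twist_le (natDegree_dilate_pencilPoly_le A) w
    rw [pencilPoly_natDegree] at hdeg
    have h1 := eval_eq_of_rotation_invariant hd hc hdeg (fun y hy => by
      rw [twist_pencilPoly_eval _ _ _ hy, twist_pencilPoly_eval _ _ _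
        (by rw [norm_mul, hc1, hy, one_mul]), h w y hy, mul_pow, hc.pow_eq_one, one_mul]) z
    rw [twist_pencilPoly_eval _ _ _ hz, coeff_twist_pencilPoly_two_mul, coeff_zero_eq_eval_zero,
      twist_pencilPoly_eval_zero] at h1
    have hzz : conj z ^ d * z ^ d = 1 := by
      rw [← mul_pow, conj_mul_self_of_norm_eq_one hz, one_pow]
    have hpow : (-1 / 2 : ℂ) ^ d = (-1 / 2 : ℂ) ^ (d - 1) * (-1 / 2) := by
      rw [← pow_succ, Nat.sub_add_cancel hd]
    have hre : (((-1 / 2 : ℝ) ^ (d - 1) * (conj z ^ d * A.det).re : ℝ) : ℂ)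
        = (-1 / 2 : ℂ) ^ (d - 1) * ((conj z ^ d * A.det + z ^ d * conj A.det) / 2) := by
      rw [Complex.ofReal_mul, Complex.re_eq_add_conj]
      simp
    rw [hre]
    rw [hpow] at h1
    linear_combination conj z ^ d * h1 + ((twist w (pencilPoly A)).coeff d -
      (w • (1 : Matrix (Fin d) (Fin d) ℂ) - hermPart A z).det
      + (-1 / 2 : ℂ) ^ (d - 1) * (-1 / 2) * conj A.det * z ^ d) * hzz
  obtain ⟨P, hP⟩ := exists_real_charpoly A
  rw [conditionC_iff]
  -- The added constant offsets the real-part term at `z = 1`.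
  refine ⟨P + C ((-1 / 2 : ℝ) ^ (d - 1) * A.det.re), fun z hz w => ?_⟩
  have h1 := hform 1 (by simp) w
  rw [hP, map_one, one_pow, one_mul] at h1
  rw [hform z hz, map_add, aeval_C, h1]
  simp

theorem ConditionC.charpoly_half {A : Matrix (Fin d) (Fin d) ℂ} (hd : 0 < d)
    (hA : ConditionC A) :
    ((1 / 2 : ℂ) • A).charpoly = X ^ d + C ((-1 / 2 : ℂ) ^ d * A.det) := by
  obtain ⟨P, hP⟩ := (conditionC_iff A).1 hA
  have hchar : ((1 / 2 : ℂ) • A).charpoly = (pencilPoly A).map (evalRingHom 0) := by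
    rw [pencilPoly, ← charpoly_map]
    congr 1
    ext i j
    simp
  have hdeg : ((1 / 2 : ℂ) • A).charpoly.natDegree = d := by
    rw [charpoly_natDegree_eq_dim, Fintype.card_fin]
  have hcoeff : ∀ b, 0 < b → b < d → ((pencilPoly A).coeff b).eval 0 = 0 := by
    intro b hb hbd
    -- Comparing coefficients of `w^b` in `(C_d)` times `z^d`; the term depending on `det A` is
    -- constant in `w`, so it only affects `b = 0`. Since `b < d`, the right side vanishes at `0`.
    have h1 : expand ℂ 2 ((pencilPoly A).coeff b) = C ((P.coeff b : ℝ) : ℂ) * X ^ (d - b) := by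
      refine eq_of_eval_eq_of_norm_eq_one fun z hz => ?_
      have hz0 : z ≠ 0 := by rw [← norm_ne_zero_iff, hz]; exact one_ne_zero
      have h2 : ((pencilPoly A).map (evalRingHom (z ^ 2))).comp (C z * X)
          = C (z ^ d) * (P.map Complex.ofRealHom -
            C (((-1 / 2 : ℝ) ^ (d - 1) * (conj z ^ d * A.det).re : ℝ) : ℂ)) := by
        refine Polynomial.funext fun w => ?_
        have h3 := twist_pencilPoly_eval A w z hz
        rw [twist_eval, hP z hz] at h3
        rw [eval_comp, eval_mul, eval_C, eval_X, h3, eval_mul, eval_C, eval_sub, eval_C, eval_map,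
          aeval_def]
        rfl
      have h4 := congrArg (fun p => coeff p b) h2
      simp only [comp_C_mul_X_coeff, coeff_map, coeff_C_mul, coeff_sub, coeff_C, hb.ne', if_false,
        sub_zero, coe_evalRingHom] at h4
      rw [expand_eval, eval_mul, eval_C, eval_pow, eval_X]
      refine mul_right_cancel₀ (pow_ne_zero b hz0) ?_
      rw [h4, mul_assoc, ← pow_add, Nat.sub_add_cancel hbd.le, mul_comm]
      rfl
    have h5 := congrArg (fun p => p.eval 0) h1
    simpa [expand_eval, (Nat.sub_pos_of_lt hbd).ne'] using h5
  ext b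
  rw [coeff_add, coeff_X_pow, coeff_C]
  rcases Nat.eq_zero_or_pos b with rfl | hb
  · rw [coeff_zero_eq_eval_zero, eval_charpoly, map_zero, zero_sub, ← neg_smul, det_smul,
      Fintype.card_fin, if_neg hd.ne, if_pos rfl, zero_add]
    norm_num
  rw [if_neg hb.ne', add_zero]
  rcases lt_trichotomy b d with hbd | rfl | hbd
  · rw [if_neg hbd.ne, hchar, coeff_map, coe_evalRingHom, hcoeff b hb hbd]
  · have := (charpoly_monic ((1 / 2 : ℂ) • A)).coeff_natDegree
    rw [hdeg] at this
    rw [this, if_pos rfl]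
  · rw [if_neg hbd.ne', coeff_eq_zero_of_natDegree_lt (by rwa [hdeg])]

theorem ConditionC.pow_eq {A : Matrix (Fin d) (Fin d) ℂ} (hd : 0 < d) (hA : ConditionC A) :
    A ^ d = ((-1 : ℂ) ^ (d - 1) * A.det) • (1 : Matrix (Fin d) (Fin d) ℂ) := by
  have h := aeval_self_charpoly ((1 / 2 : ℂ) • A)
  rw [hA.charpoly_half hd, map_add, map_pow, aeval_X, aeval_C, _root_.smul_pow,
    Algebra.algebraMap_eq_smul_one] at h
  have h2 : (2 : ℂ) ^ d * (1 / 2) ^ d = 1 := by rw [← mul_pow]; norm_num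
  have h3 : (2 : ℂ) ^ d * (-1 / 2) ^ d = (-1) ^ d := by rw [← mul_pow]; norm_num
  have h4 := congrArg (fun M => (2 : ℂ) ^ d • M) h
  simp only [smul_add, smul_smul, ← mul_assoc, h2, h3, one_smul, smul_zero] at h4
  rw [eq_neg_of_add_eq_zero_left h4, ← neg_smul]
  congr 1
  have h5 : (-1 : ℂ) ^ d = (-1) ^ (d - 1) * (-1) := by rw [← pow_succ, Nat.sub_add_cancel hd]
  rw [h5]
  ring

theorem numericalRange_eq_of_det [NeZero d] {A B : Matrix (Fin d) (Fin d) ℂ}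
    (h : ∀ z w : ℂ, ‖z‖ = 1 → (w • (1 : Matrix (Fin d) (Fin d) ℂ) - hermPart A z).det
      = (w • (1 : Matrix (Fin d) (Fin d) ℂ) - hermPart B z).det) :
    numericalRange A = numericalRange B :=
  Set.Subset.antisymm
    (numericalRange_subset_of_det fun z w hz h0 => by rw [← h z w hz, h0])
    (numericalRange_subset_of_det fun z w hz h0 => by rw [h z w hz, h0])

theorem ConditionC.numericalRange_smul_eq [NeZero d] {A : Matrix (Fin d) (Fin d) ℂ}
    (hA : ConditionC A) {c : ℂ} (hc : c ^ d = 1) :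
    numericalRange (c • A) = numericalRange A := by
  obtain ⟨P, hP⟩ := (conditionC_iff A).1 hA
  have hc1 : ‖c‖ = 1 := norm_eq_one_of_pow_eq (NeZero.ne d) norm_one (hc.trans (one_pow d).symm)
  refine numericalRange_eq_of_det fun z w hz => ?_
  rw [hermPart_smul, hP z hz, hP _ (by rw [norm_mul, RCLike.norm_conj, hc1, hz, one_mul]), map_mul,
    Complex.conj_conj, mul_pow, hc, one_mul]

/-- This gives the reflection symmetry: the condition on `c` is what preserves `Re(z̄^d det A)` when
`z` is replaced by `c z̄`. -/
theorem ConditionC.numericalRange_smul_conjTranspose_eq [NeZero d]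
    {A : Matrix (Fin d) (Fin d) ℂ} (hA : ConditionC A) {c : ℂ} (hc1 : ‖c‖ = 1)
    (hc : c ^ d * conj A.det = A.det) :
    numericalRange (c • Aᴴ) = numericalRange A := by
  obtain ⟨P, hP⟩ := (conditionC_iff A).1 hA
  refine numericalRange_eq_of_det fun z w hz => ?_
  rw [hermPart_smul, hermPart_conjTranspose, hP z hz,
    hP _ (by rw [RCLike.norm_conj, norm_mul, RCLike.norm_conj, hc1, hz, one_mul])]
  have h1 : (conj (conj (conj c * z)) ^ d * A.det).re = (conj z ^ d * A.det).re := by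
    rw [← Complex.conj_re]
    congr 1
    simp only [map_mul, map_pow, Complex.conj_conj, mul_pow]
    linear_combination conj z ^ d * hc
  rw [h1]

/-- At the common largest eigenvalue both determinants vanish and the values of `P` cancel, leaving
an equality of real parts. -/
theorem ConditionC.pow_eq_one_of_numericalRange_smul_eq [NeZero d] {A : Matrix (Fin d) (Fin d) ℂ}
    (hA : ConditionC A) (hdet : A.det ≠ 0) {c : ℂ} (hc1 : ‖c‖ = 1)
    (hW : numericalRange (c • A) = numericalRange A) : c ^ d = 1 := by
  obtain ⟨P, hP⟩ := (conditionC_iff A).1 hA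
  have key : ∀ z : ℂ, ‖z‖ = 1 → (c ^ d * (conj z ^ d * A.det)).re = (conj z ^ d * A.det).re := by
    intro z hz
    obtain ⟨l, hl, hl0⟩ := exists_isGreatest_and_det_eq_zero A z
    obtain ⟨l', hl', hl0'⟩ := exists_isGreatest_and_det_eq_zero (c • A) z
    rw [hW] at hl'
    rw [← hl.unique hl', hermPart_smul, ← hl0, hP z hz,
      hP _ (by rw [norm_mul, RCLike.norm_conj, hc1, hz, one_mul]), sub_right_inj,
      Complex.ofReal_inj] at hl0'
    have := mul_left_cancel₀ (pow_ne_zero _ (by norm_num)) hl0'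
    rw [map_mul, Complex.conj_conj, mul_pow, mul_assoc] at this
    exact this
  have hn : (0 : ℝ) < ‖A.det‖ := norm_pos_iff.2 hdet
  have hn0 : (‖A.det‖ : ℂ) ≠ 0 := by exact_mod_cast hn.ne'
  -- For `z = conj y`, the number `z̄^d det A` is `‖det A‖`, so `c^d` has real part `1`.
  obtain ⟨y, hy⟩ := IsAlgClosed.exists_pow_nat_eq (conj A.det / ‖A.det‖) (NeZero.pos d)
  have hy1 : ‖y‖ = 1 := by
    have h1 : ‖y‖ ^ d = 1 := by
      rw [← norm_pow, hy, norm_div, RCLike.norm_conj, Complex.norm_real, norm_norm,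
        div_self hn.ne']
    exact (pow_eq_one_iff_of_nonneg (norm_nonneg y) (NeZero.ne d)).1 h1
  have h := key (conj y) (by rwa [RCLike.norm_conj])
  have h2 : conj (conj y) ^ d * A.det = (‖A.det‖ : ℂ) := by
    rw [Complex.conj_conj, hy, div_mul_eq_mul_div, ← Complex.normSq_eq_conj_mul_self,
      Complex.normSq_eq_norm_sq]
    push_cast
    field_simp
  rw [h2, mul_comm, Complex.re_ofReal_mul, Complex.ofReal_re] at h
  have hre : (c ^ d).re = 1 := mul_left_cancel₀ hn.ne' (by rw [h, mul_one])
  have hnorm : ‖c ^ d‖ = 1 := by rw [norm_pow, hc1, one_pow]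
  exact (Complex.re_eq_norm.1 (by rw [hre, hnorm])) |> fun h0 => by
    rw [Complex.eq_re_of_ofReal_le h0, hre]; simp

/-! ### Planar isometries and dihedral symmetry -/

/-- The isometry `g` is one of the `2 d` linear symmetries of a regular `d`-gon centered at `0`
with a vertex in the direction of the unit vector `c`. -/
def IsDihedral (d : ℕ) (c : ℂ) (g : ℂ ≃ᵢ ℂ) : Prop :=
  ∃ a : ℂ, a ^ d = 1 ∧ ((∀ z, g z = a * z) ∨ ∀ z, g z = a * c ^ 2 * conj z)

theorem isometryEquiv_complex (g : ℂ ≃ᵢ ℂ) :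
    ∃ a p : ℂ, ‖a‖ = 1 ∧ ((∀ z, g z = a * z + p) ∨ ∀ z, g z = a * conj z + p) := by
  obtain ⟨a, ha⟩ := linear_isometry_complex g.toRealLinearIsometryEquiv
  have hg : ∀ z, g z = g.toRealLinearIsometryEquiv z + g 0 := by
    intro z
    rw [IsometryEquiv.toRealLinearIsometryEquiv_apply, sub_add_cancel]
  refine ⟨a, g 0, a.norm_coe, ?_⟩
  rcases ha with ha | ha
  · left
    intro z
    rw [hg z, ha, rotation_apply]
  · right
    intro z
    rw [hg z, ha]
    simp [rotation_apply]

/-- A nonempty bounded set is not invariant under a nontrivial translation. -/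
theorem eq_zero_of_translation_mapsTo {S : Set ℂ} (hb : Bornology.IsBounded S) (hne : S.Nonempty)
    {p : ℂ} (h : ∀ z ∈ S, z + p ∈ S) : p = 0 := by
  obtain ⟨x, hx⟩ := hne
  obtain ⟨r, hr⟩ := hb.exists_norm_le
  have hx' : ∀ n : ℕ, x + n * p ∈ S := by
    intro n
    induction n with
    | zero => simpa using hx
    | succ n ih =>
      have := h _ ih
      push_cast
      rwa [add_one_mul, ← add_assoc]
  by_contra hp
  have hp' : 0 < ‖p‖ := norm_pos_iff.2 hp
  obtain ⟨n, hn⟩ := exists_nat_gt ((r + ‖x‖) / ‖p‖)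
  rw [div_lt_iff₀ hp'] at hn
  have h1 := hr _ (hx' n)
  have h2 : ‖(n : ℂ) * p‖ ≤ ‖x + n * p‖ + ‖x‖ := by
    have := norm_sub_le (x + n * p) x
    rwa [add_sub_cancel_left] at this
  rw [norm_mul, Complex.norm_natCast] at h2
  linarith

/-- Isometries preserving a bounded set that has a nontrivial rotational symmetry about `0` are
linear. -/
theorem linear_of_mem_symmetryGroup {S : Set ℂ} (hb : Bornology.IsBounded S) (hne : S.Nonempty)
    {w : ℂ} (hw : ‖w‖ = 1) (hw1 : w ≠ 1) (hS : (fun z => w * z) '' S = S) {g : ℂ ≃ᵢ ℂ}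
    (hg : g ∈ symmetryGroup S) :
    ∃ a : ℂ, ‖a‖ = 1 ∧ ((∀ z, g z = a * z) ∨ ∀ z, g z = a * conj z) := by
  obtain ⟨a, p, ha, h⟩ := isometryEquiv_complex g
  have hgS : g '' S = S := hg
  have hww := conj_mul_self_of_norm_eq_one hw
  have hw' : conj w ≠ 1 := fun h0 => hw1 (by simpa using congrArg conj h0)
  have m1 : ∀ z ∈ S, g z ∈ S := fun z hz => hgS ▸ Set.mem_image_of_mem g hz
  have m2 : ∀ z ∈ S, w * z ∈ S := fun z hz =>
    hS.subset (Set.mem_image_of_mem _ hz)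
  have m3 : ∀ z ∈ S, ∃ y ∈ S, g y = z := fun z hz => by
    rw [← hgS] at hz; exact hz
  have m4 : ∀ z ∈ S, conj w * z ∈ S := fun z hz => by
    rw [← hS] at hz
    obtain ⟨y, hy, rfl⟩ := hz
    simpa [← mul_assoc, hww] using hy
  suffices hp : p = 0 by
    subst hp
    exact ⟨a, ha, by simpa using h⟩
  -- Composing `g`, its inverse and rotations by `w` or its conjugate gives a translation, by `(1 -
  -- conj w) p` or `(1 - w) p`; boundedness makes it trivial.
  rcases h with h | h
  · have := eq_zero_of_translation_mapsTo hb hne (p := p - conj w * p) fun z hz => by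
      obtain ⟨y, hy, rfl⟩ := m3 z hz
      have h1 := m1 _ (m4 _ (m3 _ (m2 _ hz)).choose_spec.1)
      have h2 := (m3 _ (m2 _ hz)).choose_spec.2
      rw [h] at h1 h2
      convert h1 using 1
      linear_combination (-conj w) * h2 + (g y) * (-hww)
    exact (mul_eq_zero.1 (show (1 - conj w) * p = 0 by linear_combination this)).resolve_left
      (sub_ne_zero.2 hw'.symm)
  · have := eq_zero_of_translation_mapsTo hb hne (p := p - w * p) fun z hz => by
      have h1 := m1 _ (m4 _ (m3 _ (m4 _ hz)).choose_spec.1)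
      have h2 := (m3 _ (m4 _ hz)).choose_spec.2
      rw [h] at h1 h2
      convert h1 using 1
      rw [map_mul, Complex.conj_conj]
      linear_combination (-w) * h2 - z * hww
    exact (mul_eq_zero.1 (show (1 - w) * p = 0 by linear_combination this)).resolve_left
      (sub_ne_zero.2 hw1.symm)

/-- One criterion serves both `W(A)` and the polygon: composing any reflection symmetry with the
known one gives a rotation, which `hmax` controls. -/
theorem mem_symmetryGroup_iff_isDihedral {d : ℕ} (hd : 2 ≤ d) {S : Set ℂ}
    (hb : Bornology.IsBounded S) (hne : S.Nonempty) {c : ℂ} (hc : ‖c‖ = 1)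
    (hrot : ∀ a : ℂ, a ^ d = 1 → (fun z => a * z) '' S = S)
    (hrefl : (fun z => c ^ 2 * conj z) '' S = S)
    (hmax : ∀ a : ℂ, ‖a‖ = 1 → (fun z => a * z) '' S = S → a ^ d = 1) (g : ℂ ≃ᵢ ℂ) :
    g ∈ symmetryGroup S ↔ IsDihedral d c g := by
  have hw := Complex.isPrimitiveRoot_exp d (by omega)
  have hcc := conj_mul_self_of_norm_eq_one hc
  constructor
  · intro hg
    have hgS : g '' S = S := hg
    obtain ⟨a, ha, h | h⟩ := linear_of_mem_symmetryGroup hb hne (hw.norm'_eq_one (by omega))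
      (hw.ne_one (by omega)) (hrot _ hw.pow_eq_one) hg
    · exact ⟨a, hmax a ha (by simp only [← h, hgS]), Or.inl h⟩
    · refine ⟨a * conj c ^ 2, hmax _ (by simp [ha, hc]) ?_, Or.inr fun z => ?_⟩
      · conv_lhs => rw [← hrefl]
        conv_rhs => rw [← hgS]
        rw [Set.image_image]
        refine Set.image_congr fun z _ => ?_
        rw [h]
        linear_combination a * conj z * (conj c * c + 1) * hcc
      · rw [h]
        linear_combination -(a * conj z * (conj c * c + 1) * hcc)
  · rintro ⟨a, ha, h | h⟩
    · change g '' S = S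
      conv_rhs => rw [← hrot a ha]
      exact Set.image_congr fun z _ => h z
    · change g '' S = S
      conv_rhs => rw [← hrot a ha, ← hrefl]
      rw [Set.image_image]
      refine Set.image_congr fun z _ => ?_
      rw [h, mul_assoc]

/-! ### Symmetries of the regular polygon -/

section Polygon

theorem range_vertices_eq (hd : d ≠ 0) {c : ℂ} (hc : c ≠ 0) :
    (Set.range fun k : Fin d =>
      c * Complex.exp (2 * Real.pi * Complex.I * ((k : ℕ) : ℂ) / (d : ℂ)))
      = {v | v ^ d = c ^ d} := by
  have hw := Complex.isPrimitiveRoot_exp d hd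
  have hexp : ∀ k : ℕ, Complex.exp (2 * Real.pi * Complex.I * (k : ℂ) / (d : ℂ))
      = Complex.exp (2 * Real.pi * Complex.I / d) ^ k := by
    intro k
    rw [← Complex.exp_nat_mul]
    congr 1
    ring
  ext v
  constructor
  · rintro ⟨k, rfl⟩
    change (_ * _) ^ d = _
    rw [hexp, mul_pow, ← pow_mul, mul_comm (k : ℕ) d, pow_mul, hw.pow_eq_one, one_pow, mul_one]
  · intro hv
    have hv' : v ^ d = c ^ d := hv
    obtain ⟨k, hk, hkv⟩ := (haveI : NeZero d := ⟨hd⟩; hw.eq_pow_of_pow_eq_one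
      (show (v / c) ^ d = 1 by rw [div_pow, hv', div_self (pow_ne_zero _ hc)]))
    refine ⟨⟨k, hk⟩, ?_⟩
    simp only [hexp, hkv]
    field_simp

theorem regularPolygon_eq (hd : d ≠ 0) {c : ℂ} (hc : c ≠ 0) :
    regularPolygon d c = convexHull ℝ {v | v ^ d = c ^ d} := by
  rw [regularPolygon, range_vertices_eq hd hc]

/-- Unit vectors in the convex hull of a set of unit vectors belong to the set. -/
theorem mem_of_mem_convexHull_of_norm_eq_one {V : Set ℂ} (hV : ∀ v ∈ V, ‖v‖ = 1) {x : ℂ}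
    (hx : x ∈ convexHull ℝ V) (hx1 : ‖x‖ = 1) : x ∈ V := by
  by_contra hxV
  have hconv : Convex ℝ {v : ℂ | (conj x * v).re < 1} := by
    -- Among unit vectors only `x` itself lies outside this open half-plane.
    refine convex_halfSpace_lt ⟨fun u v => ?_, fun r v => ?_⟩ 1
    · rw [mul_add, Complex.add_re]
    · rw [mul_smul_comm, Complex.smul_re]
  have hsub : V ⊆ {v : ℂ | (conj x * v).re < 1} := by
    intro v hv
    have hn : ‖conj x * v‖ = 1 := by rw [norm_mul, RCLike.norm_conj, hx1, hV v hv, one_mul]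
    refine lt_of_le_of_ne (hn ▸ Complex.re_le_norm _) fun h1 => hxV ?_
    have h2 : conj x * v = 1 := by
      have h3 := Complex.sq_norm_sub_sq_re (conj x * v)
      rw [hn, h1] at h3
      apply Complex.ext
      · simpa using h1
      · have : (conj x * v).im = 0 := by
          apply pow_eq_zero_iff two_ne_zero |>.1
          linarith
        simpa using this
    have h4 : x = v := by
      linear_combination (-x) * h2 + v * mul_conj_self_of_norm_eq_one hx1
    rwa [h4]
  have h5 : (conj x * x).re < 1 := convexHull_min hsub hconv hx
  rw [conj_mul_self_of_norm_eq_one hx1] at h5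
  simp at h5

theorem image_convexHull_of_linear (f : ℂ →ₗ[ℝ] ℂ) {V : Set ℂ} (h : f '' V = V) :
    f '' convexHull ℝ V = convexHull ℝ V := by
  rw [f.image_convexHull, h]

theorem mem_symmetryGroup_regularPolygon_iff (hd : 2 ≤ d) {c : ℂ} (hc : ‖c‖ = 1) (g : ℂ ≃ᵢ ℂ) :
    g ∈ symmetryGroup (regularPolygon d c) ↔ IsDihedral d c g := by
  have hd0 : d ≠ 0 := by omega
  have hc0 : c ≠ 0 := by rw [← norm_ne_zero_iff, hc]; exact one_ne_zero
  have hcc := conj_mul_self_of_norm_eq_one hc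
  have hV : ∀ v ∈ {v : ℂ | v ^ d = c ^ d}, ‖v‖ = 1 := fun v hv => norm_eq_one_of_pow_eq hd0 hc hv
  have hcP : c ∈ convexHull ℝ {v : ℂ | v ^ d = c ^ d} :=
    subset_convexHull ℝ _ (show c ^ d = c ^ d from rfl)
  rw [regularPolygon_eq hd0 hc0]
  refine mem_symmetryGroup_iff_isDihedral hd ?_ ⟨c, hcP⟩ hc ?_ ?_ ?_ g
  · rw [isBounded_convexHull]
    exact (Metric.isBounded_closedBall (x := (0 : ℂ)) (r := 1)).subset fun v hv => by
      simp [hV v hv]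
  · intro a ha
    refine image_convexHull_of_linear (LinearMap.mulLeft ℝ a) ?_
    have ha0 : a ≠ 0 := by rintro rfl; simp [hd0] at ha
    ext v
    constructor
    · rintro ⟨u, hu, rfl⟩
      change (a * u) ^ d = c ^ d
      rw [mul_pow, ha, one_mul]
      exact hu
    · intro hv
      refine ⟨a⁻¹ * v, ?_, by simp [ha0]⟩
      change (a⁻¹ * v) ^ d = c ^ d
      rw [mul_pow, inv_pow, ha, inv_one, one_mul]
      exact hv
  · have hmem : ∀ v ∈ {v : ℂ | v ^ d = c ^ d}, c ^ 2 * conj v ∈ {v : ℂ | v ^ d = c ^ d} := by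
      intro v hv
      change (c ^ 2 * conj v) ^ d = c ^ d
      rw [mul_pow, ← map_pow, show v ^ d = c ^ d from hv, map_pow, ← mul_pow, sq, mul_assoc,
        mul_comm c (conj c), hcc, mul_one]
    refine image_convexHull_of_linear
      ((LinearMap.mulLeft ℝ (c ^ 2)).comp Complex.conjAe.toLinearMap) ?_
    ext v
    constructor
    · rintro ⟨u, hu, rfl⟩
      exact hmem u hu
    · intro hv
      refine ⟨_, hmem v hv, ?_⟩
      change c ^ 2 * conj (c ^ 2 * conj v) = v
      rw [map_mul, map_pow, Complex.conj_conj]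
      linear_combination v * (conj c * c + 1) * hcc
  · intro a ha haS
    -- The rotation sends the vertex `c` to a unit vector of the polygon, necessarily a vertex.
    have h1 : a * c ∈ convexHull ℝ {v : ℂ | v ^ d = c ^ d} := by
      rw [← haS]
      exact Set.mem_image_of_mem _ hcP
    have h2 := mem_of_mem_convexHull_of_norm_eq_one hV h1 (by rw [norm_mul, ha, hc, one_mul])
    have h3 : (a * c) ^ d = c ^ d := h2
    rw [mul_pow] at h3
    exact mul_right_cancel₀ (pow_ne_zero d hc0) (by rw [h3, one_mul])

end Polygon

/-! ### Symmetry group of the numerical range and conclusion -/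

theorem symmetryGroup_numericalRange_eq {d : ℕ} (hd : 2 ≤ d) {A : Matrix (Fin d) (Fin d) ℂ}
    (hA : ConditionC A) (hdet : A.det ≠ 0) :
    ∃ c : ℂ, c ≠ 0 ∧ symmetryGroup (numericalRange A) = symmetryGroup (regularPolygon d c) := by
  have : NeZero d := ⟨by omega⟩
  have hn : ‖A.det‖ ≠ 0 := norm_ne_zero_iff.2 hdet
  have hn0 : (‖A.det‖ : ℂ) ≠ 0 := by exact_mod_cast hn
  -- The vertex direction satisfies `c^d = det A / ‖det A‖`, so that `c^(2d) conj(det A) = det A`,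
  -- the condition for the reflection `z ↦ c² z̄`.
  obtain ⟨c, hcd⟩ := IsAlgClosed.exists_pow_nat_eq (A.det / ‖A.det‖) (NeZero.pos d)
  have hc : ‖c‖ = 1 := by
    have h1 : ‖c‖ ^ d = 1 := by
      rw [← norm_pow, hcd, norm_div, Complex.norm_real, norm_norm, div_self hn]
    exact (pow_eq_one_iff_of_nonneg (norm_nonneg c) (NeZero.ne d)).1 h1
  refine ⟨c, by rw [← norm_ne_zero_iff, hc]; exact one_ne_zero, ?_⟩
  ext g
  rw [mem_symmetryGroup_regularPolygon_iff hd hc]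
  refine mem_symmetryGroup_iff_isDihedral hd (numericalRange_isCompact A).isBounded
    (numericalRange_nonempty A) hc (fun a ha => ?_) ?_ (fun a ha h => ?_) g
  · rw [← numericalRange_smul, hA.numericalRange_smul_eq ha]
  · have h1 := hA.numericalRange_smul_conjTranspose_eq (c := c ^ 2) (by rw [norm_pow, hc, one_pow])
      (by
        rw [← pow_mul, mul_comm 2 d, pow_mul, hcd, div_pow, div_mul_eq_mul_div, sq A.det,
          mul_assoc, Complex.mul_conj, Complex.normSq_eq_norm_sq]
        push_cast
        field_simp)
    rw [numericalRange_smul, numericalRange_conjTranspose, Set.image_image] at h1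
    exact h1
  · rw [← numericalRange_smul] at h
    exact hA.pow_eq_one_of_numericalRange_smul_eq hdet ha h

theorem rotationInvariant_numericalRange_iff {d : ℕ} (A : Matrix (Fin d) (Fin d) ℂ) :
    RotationInvariant (numericalRange A) (2 * Real.pi / d) ↔
      numericalRange (Complex.exp (2 * Real.pi * Complex.I / d) • A) = numericalRange A := by
  rw [numericalRange_smul, RotationInvariant]
  have h : ((2 * Real.pi / d : ℝ) : ℂ) * Complex.I = 2 * Real.pi * Complex.I / d := by
    push_cast
    ring
  rw [h]

end

theorem theorem1 (d : ℕ) (hd : 3 ≤ d) (A : Matrix (Fin d) (Fin d) ℂ) :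
    (ConditionC A → RotationInvariant (numericalRange A) (2 * Real.pi / d)) ∧
    (A.det ≠ 0 → RotationInvariant (numericalRange A) (2 * Real.pi / d) →
      ConditionC A ∧
      A ^ d = ((-1 : ℂ) ^ (d - 1) * A.det) • (1 : Matrix (Fin d) (Fin d) ℂ) ∧
      ∃ c : ℂ, c ≠ 0 ∧
        symmetryGroup (numericalRange A) = symmetryGroup (regularPolygon d c)) := by
  have hd0 : 0 < d := by omega
  have : NeZero d := ⟨hd0.ne'⟩
  have hw := Complex.isPrimitiveRoot_exp d hd0.ne'
  rw [rotationInvariant_numericalRange_iff]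
  refine ⟨fun hA => hA.numericalRange_smul_eq hw.pow_eq_one, fun hdet hW => ?_⟩
  have hA : ConditionC A := ConditionC.of_det_rotate hd0 hw
    fun w z hz => det_hermPart_rotate hdet hw hW w hz
  exact ⟨hA, hA.pow_eq hd0, symmetryGroup_numericalRange_eq (by omega) hA hdet⟩
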